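/- Let $V\subset H\subset V'$ be a Gelfand triple: $H$ is a real Hilbert space with norm $\|\cdot\|$ and scalar product $(\cdot,\cdot)$, $V$ is a real Banach space, embedded densely and compactly in $H$, and $H$ is embedded in the dual $V'$ by $h\mapsto (h,\cdot)|_V$. Let $A:V\to V'$ be linear, continuous and symmetric ($\langle Au,v\rangle=\langle Av,u\rangle$), with $\lambda_1\|u\|_V^2\le\langle Au,u\rangle\le\lambda_2\|u\|_V^2$ for all $u\in V$, where $0<\lambda_1<\lambda_2$, and suppose that $A\in\mathcal L(H)$, that is, $A$ is the restriction to $V$ of a bounded linear operator on $H$. For subsets of $H$ write $\mathrm{dist}(C,D)=\sup_{a\in C}\inf_{b\in D}\|a-b\|$ and $\mathrm{dist}_H(C,D)=\max\{\mathrm{dist}(C,D),\mathrm{dist}(D,C)\}$. Call a map $\Phi$ from $H$ to the non-empty subsets of $H$ *admissible* if its values are closed, convex and bounded, if for every $y_0\in H$ and $\varepsilon>0$ there is $\delta>0$ such that $\|y-y_0\|<\delta$ implies $\Phi(y)\subset\{z:\mathrm{dist}(z,\Phi(y_0))<\varepsilon\}$, and if there are $C_1,C_2>0$ with $\sup_{a\in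 \Phi(y)}\|a\|\le C_1+C_2\|y\|$ for all $y\in H$. A solution of $\frac{dy}{dt}+Ay\in \Phi(y)$ is a function $y\in C([0,\infty);H)$ such that for every $T>0$: $y\in L^2(0,T;V)$, $\frac{dy}{dt}\in L^2(0,T;V')$, and there is $f\in L^2(0,T;H)$ with $\frac{dy}{dt}+Ay=f(t)$ and $f(t)\in \Phi(y(t))$ for a.a. $t\in(0,T)$. Let $F$ be admissible, and assume that there are maps $F_N$ ($N\ge1$) from $H$ to the non-empty, closed, convex, bounded subsets of $H$ and constants $c_N>0$ such that for all $y,y_1,y_2\in H$ $$F(y)\subset F_N(y),\qquad \mathrm{dist}(F_N(y),F(y))\to0\ \ (N\to\infty),\qquad \mathrm{dist}_H(F_N(y_1),F_N(y_2))\le c_N\|y_1-y_2\| .$$ Let $\mathcal K$ be the set of all solutions of $\frac{dy}{dt}+Ay\in F(y)$, and $G(t,x)=\{\varphi(t):\varphi\in\mathcal K,\ \varphi(0)=x\}$ for $t\ge0$, $x\in H$. Let $B\subset H$ be compact and connected. Suppose that $B$ is quasi-invariant: for every $x\in B$ there is $\phi:\mathbb R\to B$ with $\phi(0)=x$ and $\phi(\cdot+h)|_{[0,\infty)}\in\mathcal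 K$ for all $h\in\mathbb R$. Suppose also that $B$ is chain recurrent with respect to $G$: for all $y\in B$, $\varepsilon>0$, $t>0$ there are $n\ge1$, points $y=y_1,y_2,\dots,y_{n+1}=y$ of $B$ and times $t_1,\dots,t_n\ge t$ with $\mathrm{dist}(y_{i+1},G(t_i,y_i))<\varepsilon$ for $i=1,\dots,n$. Then there are admissible maps $F^N$ ($N\ge1$) with $\mathrm{dist}_H(F^N(y),F(y))\to0$ as $N\to\infty$ for every $y\in H$, such that for every $y_0\in B$ and every $N\ge1$ there is a solution $y_N$ of $\frac{dy}{dt}+Ay\in F^N(y)$ with $y_N(0)=y_0$ and $$B\subset\omega(y_N)=\bigcap_{\tau\ge0}\overline{\{y_N(t):t\ge\tau\}} .$$ -/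

import Mathlib

open Set Filter Topology MeasureTheory
open scoped NNReal ENNReal InnerProductSpace

namespace EvolInclusion

section Dynamics

variable {X : Type*} [MetricSpace X]

/-- Hausdorff semidistance `dist(A, B) = sup_{a ∈ A} inf_{b ∈ B} ρ(a, b)`, with values in
`[0, ∞]`. -/
noncomputable def semidist (A B : Set X) : ℝ≥0∞ :=
  ⨆ a ∈ A, Metric.infEDist a B

/-- The multivalued map `G(t, x) = {φ(t) : φ ∈ K, φ(0) = x}` of a family of trajectories. -/
def flowMap (K : Set C(ℝ≥0, X)) (t : ℝ≥0) (x : X) : Set X :=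
  {y | ∃ φ ∈ K, φ 0 = x ∧ φ t = y}

/-- `φ : ℝ → X` is a complete trajectory of `K`: every restriction `φ(· + h)|_{[0, ∞)}`
belongs to `K`. -/
def IsCompleteTrajectory (K : Set C(ℝ≥0, X)) (φ : ℝ → X) : Prop :=
  ∀ h : ℝ, ∃ ψ ∈ K, ∀ t : ℝ≥0, ψ t = φ ((t : ℝ) + h)

/-- Through every point `x` of `B` there passes (at time `0`) a complete trajectory that stays
in `B`. -/
def IsQuasiInvariant (K : Set C(ℝ≥0, X)) (B : Set X) : Prop :=
  ∀ x ∈ B, ∃ φ : ℝ → X, IsCompleteTrajectory K φ ∧ φ 0 = x ∧ ∀ t, φ t ∈ B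

/-- There is an `(ε, t)`-chain in `B` from `y` to `z`, with at least one link. -/
def HasChain (G : ℝ≥0 → X → Set X) (B : Set X) (ε : ℝ) (t : ℝ≥0) (y z : X) : Prop :=
  ∃ (n : ℕ) (p : Fin (n + 1) → X) (τ : Fin n → ℝ≥0), 1 ≤ n ∧
    p 0 = y ∧ p (Fin.last n) = z ∧ (∀ i, p i ∈ B) ∧ (∀ i, t ≤ τ i) ∧
    ∀ i : Fin n, Metric.infEDist (p i.succ) (G (τ i) (p i.castSucc)) < ENNReal.ofReal ε

/-- Every point of `B` is joined to itself by `(ε, t)`-chains in `B`, for all `ε, t > 0`. -/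
def IsChainRecurrent (G : ℝ≥0 → X → Set X) (B : Set X) : Prop :=
  ∀ y ∈ B, ∀ ε : ℝ, 0 < ε → ∀ t : ℝ≥0, 0 < t → HasChain G B ε t y y

/-- The `ω`-limit set `⋂_{τ ≥ 0} closure {φ(t) : t ≥ τ}`. -/
def omegaLimitSet (φ : C(ℝ≥0, X)) : Set X :=
  ⋂ τ : ℝ≥0, closure (φ '' Ici τ)

end Dynamics

section Multimaps

variable {H : Type*} [NormedAddCommGroup H] [NormedSpace ℝ H]

/-- The values of `F` are non-empty, closed, convex and bounded. -/
structure HasNiceValues (F : H → Set H) : Prop where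
  nonempty : ∀ y, (F y).Nonempty
  isClosed : ∀ y, IsClosed (F y)
  convex : ∀ y, Convex ℝ (F y)
  isBounded : ∀ y, Bornology.IsBounded (F y)

/-- w-upper semicontinuity: upper semicontinuity with respect to the metric neighbourhoods
`O_ε(F(y₀)) = {z : dist(z, F(y₀)) < ε}` of the values. -/
def IsWUpperSemicontinuous (F : H → Set H) : Prop :=
  ∀ y₀ : H, ∀ ε : ℝ, 0 < ε → ∃ δ : ℝ, 0 < δ ∧
    ∀ y : H, ‖y - y₀‖ < δ → F y ⊆ Metric.thickening ε (F y₀)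

/-- The standing assumptions on the right-hand side: non-empty closed convex bounded values,
w-upper semicontinuity, and at most linear growth. -/
structure IsAdmissible (F : H → Set H) : Prop where
  values : HasNiceValues F
  wusc : IsWUpperSemicontinuous F
  growth : ∃ C₁ C₂ : ℝ, 0 < C₁ ∧ 0 < C₂ ∧ ∀ y, ∀ a ∈ F y, ‖a‖ ≤ C₁ + C₂ * ‖y‖

/-- `F_N`, `N ≥ 1`, are globally Lipschitz outer approximations of `F` that converge to `F`
pointwise. -/
structure IsLipschitzApproximation (F : H → Set H) (FN : ℕ → H → Set H) : Prop where
  values : ∀ N, 1 ≤ N → HasNiceValues (FN N)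
  subset : ∀ N, 1 ≤ N → ∀ y, F y ⊆ FN N y
  tendsto : ∀ y, Tendsto (fun N => semidist (FN N y) (F y)) atTop (𝓝 0)
  lipschitz : ∀ N, 1 ≤ N → ∃ c : ℝ, 0 < c ∧ ∀ y₁ y₂,
    Metric.hausdorffEDist (FN N y₁) (FN N y₂) ≤ ENNReal.ofReal (c * ‖y₁ - y₂‖)

end Multimaps

section Inclusion

variable {V H : Type*} [NormedAddCommGroup V] [NormedSpace ℝ V]
  [NormedAddCommGroup H] [InnerProductSpace ℝ H]

/-- The image in `V'` of `h ∈ H` under the embedding `H ⊂ V'` dual to `ι : V → H`, that is, the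
functional `v ↦ (h, ι v)`. -/
noncomputable def toDual (ι : V →L[ℝ] H) (h : H) : V →L[ℝ] ℝ :=
  (innerSL ℝ h).comp ι

/-- `y ∈ C([0, ∞); H)` is a solution of `dy/dt + A y ∈ F(y)`: for every `T > 0` there are
`v ∈ L²(0, T; V)`, `w ∈ L²(0, T; V')` and `f ∈ L²(0, T; H)` such that `y = v` almost everywhere
on `(0, T)`, `w` is the derivative of `y` (that is, `y`, as a function with values in `V'`, is
the primitive of `w`), and `w + A v = f`, `f(t) ∈ F(y(t))` for almost all `t ∈ (0, T)`. -/
def IsSolution (ι : V →L[ℝ] H) (A : V →L[ℝ] (V →L[ℝ] ℝ)) (F : H → Set H)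
    (y : C(ℝ≥0, H)) : Prop :=
  ∀ T : ℝ, 0 < T → ∃ (v : ℝ → V) (w : ℝ → (V →L[ℝ] ℝ)) (f : ℝ → H),
    MemLp v 2 (volume.restrict (Ioo 0 T)) ∧
    MemLp w 2 (volume.restrict (Ioo 0 T)) ∧
    MemLp f 2 (volume.restrict (Ioo 0 T)) ∧
    (∀ᵐ t ∂volume.restrict (Ioo 0 T), ι (v t) = y t.toNNReal) ∧
    (∀ t : ℝ≥0, (t : ℝ) ≤ T →
      toDual ι (y t) = toDual ι (y 0) + ∫ s in (0 : ℝ)..t, w s) ∧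
    (∀ᵐ t ∂volume.restrict (Ioo 0 T),
      w t + A (v t) = toDual ι (f t) ∧ f t ∈ F (y t.toNNReal))

/-- The family of all solutions of `dy/dt + A y ∈ F(y)` on `[0, ∞)`. -/
def solutions (ι : V →L[ℝ] H) (A : V →L[ℝ] (V →L[ℝ] ℝ)) (F : H → Set H) :
    Set C(ℝ≥0, H) :=
  {y | IsSolution ι A F y}

end Inclusion

end EvolInclusion

open EvolInclusion

/-! Coercivity on `V` and boundedness of `A` on `H` force the dense embedding `ι` to be onto
(`surjective_of_coercive_of_bounded`), so every vector of `H` may serve as a correction of a path in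
`V`.

Enlarge `F_N` to its closed `1/(N+1)`-neighbourhood. The margin absorbs small errors: if a
trajectory of `F` on `[0, τ]`, `τ ≥ 1`, ends within `ε` of `z`, adding `(t/τ) • ι e` makes it end at
`z`. This moves the state by at most `ε` and the forcing by at most `(1 + ‖A'‖) ε`, which the
Lipschitz bound and the enlargement tolerate (`steers_of_infEDist_lt`).

Chains of `F` in `B` thus become true solutions of the enlarged inclusion. Connectedness of `B` then
lets any point be steered to any other (`steers_of_isChainRecurrent`), and a solution that visits
each point of a countable dense subset of `B` at arbitrarily late times is obtained by gluing
(`exists_solution_through`). -/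

namespace EvolInclusion

/-! ### Closed neighbourhoods of Lipschitz multimaps -/

section Multimaps

theorem infEDist_le_infEDist_add_semidist {X : Type*} [MetricSpace X] (x : X) (S F : Set X) :
    Metric.infEDist x F ≤ Metric.infEDist x S + semidist S F := by
  refine ENNReal.le_of_forall_pos_le_add fun η hη hfin => ?_
  have hne : Metric.infEDist x S ≠ ∞ :=
    ne_top_of_le_ne_top hfin.ne le_self_add
  obtain ⟨s, hs, hxs⟩ := Metric.infEDist_lt_iff.1
    (ENNReal.lt_add_right hne (ENNReal.coe_pos.2 hη).ne')
  calc Metric.infEDist x F ≤ Metric.infEDist s F + edist x s :=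
        Metric.infEDist_le_infEDist_add_edist
    _ ≤ semidist S F + (Metric.infEDist x S + η) :=
        add_le_add (le_iSup₂ (f := fun a (_ : a ∈ S) => Metric.infEDist a F) s hs) hxs.le
    _ = Metric.infEDist x S + semidist S F + η := by ring

variable {H : Type*} [NormedAddCommGroup H] [NormedSpace ℝ H]

theorem HasNiceValues.cthickening {F : H → Set H} (hF : HasNiceValues F) (δ : ℝ) :
    HasNiceValues fun y => Metric.cthickening δ (F y) where
  nonempty y := (hF.nonempty y).mono (Metric.self_subset_cthickening _)
  isClosed _ := Metric.isClosed_cthickening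
  convex y := (hF.convex y).cthickening δ
  isBounded y := (hF.isBounded y).cthickening

theorem subset_cthickening_of_hausdorffEDist_le {X : Type*} [MetricSpace X] {S T : Set X} {r : ℝ}
    (h : Metric.hausdorffEDist S T ≤ ENNReal.ofReal r) : S ⊆ Metric.cthickening r T :=
  fun _ hx => Metric.mem_cthickening_iff.2 ((Metric.infEDist_le_hausdorffEDist_of_mem hx).trans h)

/-- A closed neighbourhood of a Lipschitz multimap is admissible. -/
theorem HasNiceValues.isAdmissible_cthickening {F : H → Set H} (hF : HasNiceValues F) {c δ : ℝ}
    (hc : 0 < c) (hδ : 0 ≤ δ) (hlip : ∀ y₁ y₂,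
      Metric.hausdorffEDist (F y₁) (F y₂) ≤ ENNReal.ofReal (c * ‖y₁ - y₂‖)) :
    IsAdmissible fun y => Metric.cthickening δ (F y) where
  values := hF.cthickening δ
  wusc y₀ ε hε := by
    refine ⟨ε / c, by positivity, fun y hy => ?_⟩
    have hlt : c * ‖y - y₀‖ < ε := by rwa [lt_div_iff₀' hc] at hy
    have hsub := subset_cthickening_of_hausdorffEDist_le (hlip y y₀)
    refine (Metric.cthickening_subset_of_subset δ hsub).trans ?_
    -- In a normed space the two enlargements commute; with `δ` innermost, the outer radius `c * ‖y
    -- - y₀‖` is below `ε`.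
    rw [cthickening_cthickening hδ (by positivity), add_comm,
      ← cthickening_cthickening (by positivity) hδ]
    exact Metric.cthickening_subset_thickening' hε hlt _
  growth := by
    obtain ⟨M, hM⟩ := (hF.isBounded 0).exists_norm_le
    have hM0 : 0 ≤ M := by
      obtain ⟨a, ha⟩ := hF.nonempty 0
      exact (norm_nonneg a).trans (hM a ha)
    -- The summand `1` pays for passing from the closed to an open thickening, where a nearby point
    -- of `F 0` exists.
    refine ⟨M + δ + 1, c, by positivity, hc, fun y a ha => ?_⟩
    have hsub := subset_cthickening_of_hausdorffEDist_le (hlip y 0)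
    have ha' := Metric.cthickening_subset_of_subset δ hsub ha
    rw [cthickening_cthickening hδ (by positivity), sub_zero] at ha'
    obtain ⟨b, hb, hab⟩ := Metric.mem_thickening_iff.1
      (Metric.cthickening_subset_thickening' (δ₂ := δ + c * ‖y‖ + 1) (by positivity)
        (by linarith) _ ha')
    have h1 := hM b hb
    rw [dist_eq_norm] at hab
    have h2 := norm_le_norm_add_norm_sub b a
    rw [norm_sub_rev] at h2
    linarith

/-- One semidistance vanishes because `F ⊆ F' N`; the other is at most `δ N` plus that of `F' N y`
from `F y`. -/
theorem tendsto_hausdorffEDist_cthickening {F : H → Set H} {F' : ℕ → H → Set H}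
    (hF' : IsLipschitzApproximation F F') {δ : ℕ → ℝ} (hδ : Tendsto δ atTop (𝓝 0)) (y : H) :
    Tendsto (fun N => Metric.hausdorffEDist (Metric.cthickening (δ N) (F' N y)) (F y))
      atTop (𝓝 0) := by
  have hlim : Tendsto (fun N => ENNReal.ofReal (δ N) + semidist (F' N y) (F y)) atTop (𝓝 0) := by
    simpa using (ENNReal.tendsto_ofReal hδ).add (hF'.tendsto y)
  refine tendsto_of_tendsto_of_tendsto_of_le_of_le' tendsto_const_nhds hlim
    (Eventually.of_forall fun _ => zero_le) ?_
  filter_upwards [eventually_ge_atTop 1] with N hN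
  refine Metric.hausdorffEDist_le_of_infEDist (fun x hx => ?_) fun x hx => ?_
  · exact (infEDist_le_infEDist_add_semidist x (F' N y) (F y)).trans
      (add_le_add_left (Metric.mem_cthickening_iff.1 hx) _)
  · rw [Metric.infEDist_zero_of_mem
      (Metric.self_subset_cthickening _ (hF'.subset N hN y hx))]
    exact zero_le

end Multimaps

/-! ### Restriction, translation and gluing of solutions -/

section Segments

variable {V H : Type*} [NormedAddCommGroup V] [NormedSpace ℝ V]
  [NormedAddCommGroup H] [InnerProductSpace ℝ H]

theorem toDual_add (ι : V →L[ℝ] H) (h k : H) : toDual ι (h + k) = toDual ι h + toDual ι k := by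
  ext v; simp [toDual]

theorem toDual_smul (ι : V →L[ℝ] H) (r : ℝ) (h : H) : toDual ι (r • h) = r • toDual ι h := by
  ext v; simp [toDual]

/-- `y` solves `dy/dt + A y ∈ F(y)` on the interval `[a, b]`. -/
def IsSolutionOn (ι : V →L[ℝ] H) (A : V →L[ℝ] (V →L[ℝ] ℝ)) (F : H → Set H) (a b : ℝ)
    (y : ℝ → H) : Prop :=
  ContinuousOn y (Icc a b) ∧ ∃ (v : ℝ → V) (w : ℝ → (V →L[ℝ] ℝ)) (f : ℝ → H),
    MemLp v 2 (volume.restrict (Ioc a b)) ∧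
    MemLp w 2 (volume.restrict (Ioc a b)) ∧
    MemLp f 2 (volume.restrict (Ioc a b)) ∧
    (∀ᵐ t ∂volume.restrict (Ioc a b), ι (v t) = y t) ∧
    (∀ t ∈ Icc a b, toDual ι (y t) = toDual ι (y a) + ∫ s in a..t, w s) ∧
    (∀ᵐ t ∂volume.restrict (Ioc a b), w t + A (v t) = toDual ι (f t) ∧ f t ∈ F (y t))

variable {ι : V →L[ℝ] H} {A : V →L[ℝ] (V →L[ℝ] ℝ)} {F : H → Set H} {a b c : ℝ} {y z : ℝ → H}

theorem IsSolutionOn.congr (hy : IsSolutionOn ι A F a b y) (hab : a ≤ b)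
    (h : EqOn z y (Icc a b)) : IsSolutionOn ι A F a b z := by
  obtain ⟨hc, v, w, f, hv, hw, hf, hvy, hint, heq⟩ := hy
  refine ⟨hc.congr h, v, w, f, hv, hw, hf, ?_, fun t ht => ?_, ?_⟩
  · filter_upwards [hvy, ae_restrict_mem measurableSet_Ioc] with t ht hmem
    rw [ht, h (Ioc_subset_Icc_self hmem)]
  · rw [h ht, h (left_mem_Icc.2 hab), hint t ht]
  · filter_upwards [heq, ae_restrict_mem measurableSet_Ioc] with t ht hmem
    rwa [h (Ioc_subset_Icc_self hmem)]

theorem IsSolutionOn.mono_right (hy : IsSolutionOn ι A F a c y) (hbc : b ≤ c) :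
    IsSolutionOn ι A F a b y := by
  obtain ⟨hc, v, w, f, hv, hw, hf, hvy, hint, heq⟩ := hy
  have hle : volume.restrict (Ioc a b) ≤ volume.restrict (Ioc a c) :=
    Measure.restrict_mono (Ioc_subset_Ioc_right hbc) le_rfl
  exact ⟨hc.mono (Icc_subset_Icc_right hbc), v, w, f, hv.mono_measure hle, hw.mono_measure hle,
    hf.mono_measure hle, ae_mono hle hvy, fun t ht => hint t (Icc_subset_Icc_right hbc ht),
    ae_mono hle heq⟩

theorem memLp_comp_sub_right {E : Type*} [NormedAddCommGroup E] {g : ℝ → E} {p : ℝ≥0∞} (s : ℝ)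
    (hg : MemLp g p (volume.restrict (Ioc a b))) :
    MemLp (fun t => g (t - s)) p (volume.restrict (Ioc (a + s) (b + s))) := by
  have hmp := (measurePreserving_sub_right volume s).restrict_preimage
    (measurableSet_Ioc (a := a) (b := b))
  rw [preimage_sub_const_Ioc] at hmp
  exact hg.comp_measurePreserving hmp

theorem ae_restrict_comp_sub_right {p : ℝ → Prop} (s : ℝ)
    (hp : ∀ᵐ t ∂volume.restrict (Ioc a b), p t) :
    ∀ᵐ t ∂volume.restrict (Ioc (a + s) (b + s)), p (t - s) := by
  have hmp := (measurePreserving_sub_right volume s).restrict_preimage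
    (measurableSet_Ioc (a := a) (b := b))
  rw [preimage_sub_const_Ioc] at hmp
  exact hmp.quasiMeasurePreserving.ae hp

theorem IsSolutionOn.comp_sub_right (hy : IsSolutionOn ι A F a b y) (s : ℝ) :
    IsSolutionOn ι A F (a + s) (b + s) fun t => y (t - s) := by
  obtain ⟨hc, v, w, f, hv, hw, hf, hvy, hint, heq⟩ := hy
  refine ⟨?_, fun t => v (t - s), fun t => w (t - s), fun t => f (t - s),
    memLp_comp_sub_right s hv, memLp_comp_sub_right s hw, memLp_comp_sub_right s hf,
    ae_restrict_comp_sub_right s hvy, fun t ht => ?_, ae_restrict_comp_sub_right s heq⟩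
  · refine hc.comp (by fun_prop) fun t ht => ?_
    exact ⟨by linarith [ht.1], by linarith [ht.2]⟩
  · rw [intervalIntegral.integral_comp_sub_right]
    simp only [add_sub_cancel_right]
    exact hint (t - s) ⟨by linarith [ht.1], by linarith [ht.2]⟩

theorem memLp_piecewise_Iic {E : Type*} [NormedAddCommGroup E] {g₁ g₂ : ℝ → E} {p : ℝ≥0∞}
    (hab : a ≤ b) (hbc : b ≤ c) (h₁ : MemLp g₁ p (volume.restrict (Ioc a b)))
    (h₂ : MemLp g₂ p (volume.restrict (Ioc b c))) :
    MemLp ((Iic b).piecewise g₁ g₂) p (volume.restrict (Ioc a c)) := by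
  refine MemLp.piecewise measurableSet_Iic ?_ ?_
  · rwa [Measure.restrict_restrict measurableSet_Iic, inter_comm, Ioc_inter_Iic, inf_eq_right.2 hbc]
  · rwa [Measure.restrict_restrict measurableSet_Iic.compl, compl_Iic, inter_comm, Ioc_inter_Ioi,
      sup_eq_right.2 hab]

theorem ae_restrict_Ioc_of_split {p q r : ℝ → Prop} (hab : a ≤ b) (hbc : b ≤ c)
    (h₁ : ∀ᵐ t ∂volume.restrict (Ioc a b), p t) (h₂ : ∀ᵐ t ∂volume.restrict (Ioc b c), q t)
    (hp : ∀ t ≤ b, p t → r t) (hq : ∀ t, b < t → q t → r t) :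
    ∀ᵐ t ∂volume.restrict (Ioc a c), r t := by
  rw [← Ioc_union_Ioc_eq_Ioc hab hbc, ae_restrict_union_iff]
  constructor
  · filter_upwards [h₁, ae_restrict_mem measurableSet_Ioc] with t ht hmem using hp t hmem.2 ht
  · filter_upwards [h₂, ae_restrict_mem measurableSet_Ioc] with t ht hmem using hq t hmem.1 ht

/-- The derivative is encoded by its primitive, so additivity of the integral suffices to glue at
`b`. -/
theorem IsSolutionOn.trans (hab : a ≤ b) (hbc : b ≤ c) (h₁ : IsSolutionOn ι A F a b y)
    (h₂ : IsSolutionOn ι A F b c y) : IsSolutionOn ι A F a c y := by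
  obtain ⟨hc₁, v₁, w₁, f₁, hv₁, hw₁, hf₁, hvy₁, hint₁, heq₁⟩ := h₁
  obtain ⟨hc₂, v₂, w₂, f₂, hv₂, hw₂, hf₂, hvy₂, hint₂, heq₂⟩ := h₂
  have hw := memLp_piecewise_Iic hab hbc hw₁ hw₂
  have key₁ : ∀ t ∈ Icc a b, ∫ s in a..t, (Iic b).piecewise w₁ w₂ s = ∫ s in a..t, w₁ s := by
    intro t ht
    refine intervalIntegral.integral_congr fun s hs => ?_
    rw [uIcc_of_le ht.1] at hs
    exact piecewise_eq_of_mem _ _ _ (hs.2.trans ht.2)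
  refine ⟨?_, (Iic b).piecewise v₁ v₂, (Iic b).piecewise w₁ w₂, (Iic b).piecewise f₁ f₂,
    memLp_piecewise_Iic hab hbc hv₁ hv₂, hw, memLp_piecewise_Iic hab hbc hf₁ hf₂, ?_, ?_, ?_⟩
  · rw [← Icc_union_Icc_eq_Icc hab hbc]
    exact hc₁.union_of_isClosed hc₂ isClosed_Icc isClosed_Icc
  · refine ae_restrict_Ioc_of_split hab hbc hvy₁ hvy₂ (fun t ht h => ?_) fun t ht h => ?_
    · rwa [piecewise_eq_of_mem _ _ _ (mem_Iic.2 ht)]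
    · rwa [piecewise_eq_of_notMem _ _ _ (notMem_Iic.2 ht)]
  · intro t ht
    rcases le_total t b with htb | hbt
    · rw [key₁ t ⟨ht.1, htb⟩, hint₁ t ⟨ht.1, htb⟩]
    · have hii : IntervalIntegrable ((Iic b).piecewise w₁ w₂) volume a c :=
        (intervalIntegrable_iff_integrableOn_Ioc_of_le (hab.trans hbc)).2
          (hw.integrable one_le_two)
      have key₂ : ∫ s in b..t, (Iic b).piecewise w₁ w₂ s = ∫ s in b..t, w₂ s := by
        refine intervalIntegral.integral_congr_ae (ae_of_all _ fun s hs => ?_)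
        rw [uIoc_of_le hbt] at hs
        exact piecewise_eq_of_notMem _ _ _ (notMem_Iic.2 hs.1)
      rw [← intervalIntegral.integral_add_adjacent_intervals (b := b)
        (hii.mono_set (by rw [uIcc_of_le hab, uIcc_of_le (hab.trans hbc)]
                          exact Icc_subset_Icc_right hbc))
        (hii.mono_set (by rw [uIcc_of_le hbt, uIcc_of_le (hab.trans hbc)]
                          exact Icc_subset_Icc hab ht.2)),
        key₁ b ⟨hab, le_rfl⟩, key₂, ← add_assoc, ← hint₁ b ⟨hab, le_rfl⟩]
      exact hint₂ t ⟨hbt, ht.2⟩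
  · refine ae_restrict_Ioc_of_split hab hbc heq₁ heq₂ (fun t ht h => ?_) fun t ht h => ?_
    · simpa only [piecewise_eq_of_mem _ _ _ (mem_Iic.2 ht)] using h
    · simpa only [piecewise_eq_of_notMem _ _ _ (notMem_Iic.2 ht)] using h

theorem isSolution_of_isSolutionOn {φ : C(ℝ≥0, H)} (hφ : ∀ t : ℝ≥0, φ t = y t)
    (hy : ∀ T : ℝ, 0 < T → IsSolutionOn ι A F 0 T y) : IsSolution ι A F φ := by
  intro T hT
  obtain ⟨-, v, w, f, hv, hw, hf, hvy, hint, heq⟩ := hy T hT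
  rw [← Measure.restrict_congr_set (Ioo_ae_eq_Ioc (μ := volume) (a := (0 : ℝ)) (b := T))]
    at hv hw hf hvy heq
  have hφ' : ∀ t ∈ Ioo 0 T, φ t.toNNReal = y t := fun t ht => by
    rw [hφ, Real.coe_toNNReal t ht.1.le]
  refine ⟨v, w, f, hv, hw, hf, ?_, fun t ht => ?_, ?_⟩
  · filter_upwards [hvy, ae_restrict_mem measurableSet_Ioo] with t ht hmem
    rw [ht, hφ' t hmem]
  · rw [hφ, hφ, NNReal.coe_zero]
    exact hint t ⟨t.2, ht⟩
  · filter_upwards [heq, ae_restrict_mem measurableSet_Ioo] with t ht hmem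
    rwa [hφ' t hmem]

theorem IsSolution.isSolutionOn {φ : C(ℝ≥0, H)} (hφ : IsSolution ι A F φ) {T : ℝ} (hT : 0 < T) :
    IsSolutionOn ι A F 0 T fun t => φ t.toNNReal := by
  obtain ⟨v, w, f, hv, hw, hf, hvy, hint, heq⟩ := hφ T hT
  rw [Measure.restrict_congr_set (Ioo_ae_eq_Ioc (μ := volume) (a := (0 : ℝ)) (b := T))]
    at hv hw hf hvy heq
  refine ⟨(φ.continuous.comp continuous_real_toNNReal).continuousOn, v, w, f, hv, hw, hf, hvy,
    fun t ht => ?_, heq⟩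
  have := hint t.toNNReal (by rw [Real.coe_toNNReal t ht.1]; exact ht.2)
  rwa [Real.coe_toNNReal t ht.1, ← Real.toNNReal_zero] at this

/-! ### Linear correction of a path -/

theorem Continuous.memLp_restrict_Ioc {E : Type*} [NormedAddCommGroup E] {g : ℝ → E}
    (hg : Continuous g) (p : ℝ≥0∞) (a b : ℝ) : MemLp g p (volume.restrict (Ioc a b)) := by
  obtain ⟨C, hC⟩ := isCompact_Icc.exists_bound_of_continuousOn (s := Icc a b) hg.continuousOn
  refine MemLp.of_bound hg.aestronglyMeasurable C ?_
  filter_upwards [ae_restrict_mem measurableSet_Ioc] with t ht using hC t (Ioc_subset_Icc_self ht)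

theorem MemLp.add_const_restrict_Ioc {E : Type*} [NormedAddCommGroup E] {g : ℝ → E} {p : ℝ≥0∞}
    (hg : MemLp g p (volume.restrict (Ioc a b))) (k : E) :
    MemLp (fun t => g t + k) p (volume.restrict (Ioc a b)) :=
  hg.add (memLp_const k)

theorem integral_add_const_of_memLp {E : Type*} [NormedAddCommGroup E] [NormedSpace ℝ E]
    [CompleteSpace E] {g : ℝ → E} (hg : MemLp g 2 (volume.restrict (Ioc a b))) (k : E) {t : ℝ}
    (ht : t ∈ Icc a b) : ∫ s in a..t, (g s + k) = (∫ s in a..t, g s) + (t - a) • k := by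
  have hgt : IntervalIntegrable g volume a t :=
    (intervalIntegrable_iff_integrableOn_Ioc_of_le ht.1).2
      ((hg.mono_measure (Measure.restrict_mono (Ioc_subset_Ioc_right ht.2) le_rfl)).integrable
        one_le_two)
  rw [intervalIntegral.integral_add hgt intervalIntegrable_const, intervalIntegral.integral_const]

/-- A solution on `[0, τ]` can be steered by a linear correction `(t / τ) ι e` of its path. -/
theorem IsSolutionOn.add_linear {F' : H → Set H} {A' : H →L[ℝ] H}
    (hA' : ∀ u : V, A u = toDual ι (A' (ι u))) {τ : ℝ} (e : V)
    (hy : IsSolutionOn ι A F 0 τ y)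
    (hF : ∀ t ∈ Ioc 0 τ, ∀ f ∈ F (y t),
      f + (τ⁻¹ • ι e + (t / τ) • A' (ι e)) ∈ F' (y t + (t / τ) • ι e)) :
    IsSolutionOn ι A F' 0 τ fun t => y t + (t / τ) • ι e := by
  obtain ⟨hc, v, w, f, hv, hw, hf, hvy, hint, heq⟩ := hy
  have hv' : MemLp (fun t : ℝ => (t / τ) • e) 2 (volume.restrict (Ioc 0 τ)) :=
    Continuous.memLp_restrict_Ioc (by fun_prop) _ _ _
  have hf' : MemLp (fun t : ℝ => τ⁻¹ • ι e + (t / τ) • A' (ι e)) 2 (volume.restrict (Ioc 0 τ)) :=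
    Continuous.memLp_restrict_Ioc (by fun_prop) _ _ _
  have hc' : ContinuousOn (fun t : ℝ => (t / τ) • ι e) (Icc 0 τ) := by fun_prop
  -- The extra forcing is the derivative of the correction plus `A` applied to it; it lies in `H`
  -- since `A` acts through `A'`.
  refine ⟨hc.add hc', fun t => v t + (t / τ) • e, fun t => w t + τ⁻¹ • toDual ι (ι e),
    fun t => f t + (τ⁻¹ • ι e + (t / τ) • A' (ι e)),
    hv.add hv', MemLp.add_const_restrict_Ioc hw _, hf.add hf', ?_, fun t ht => ?_, ?_⟩
  · filter_upwards [hvy] with t ht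
    rw [map_add, map_smul, ht]
  · rw [integral_add_const_of_memLp hw _ ht, toDual_add, hint t ht, toDual_smul, sub_zero,
      smul_smul, add_assoc, div_eq_mul_inv]
    simp only [zero_div, zero_smul, add_zero]
  · filter_upwards [heq, ae_restrict_mem measurableSet_Ioc] with t ht hmem
    refine ⟨?_, hF t hmem _ ht.2⟩
    rw [toDual_add, ← ht.1, toDual_add, toDual_smul, toDual_smul, map_add, map_smul, hA' e]
    abel

/-! ### Steering between points of the chain recurrent set -/

/-- There is a solution on an interval of length at least one that leads from `x` to `z`. -/
def Steers (ι : V →L[ℝ] H) (A : V →L[ℝ] (V →L[ℝ] ℝ)) (F : H → Set H) (x z : H) : Prop :=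
  ∃ τ : ℝ, 1 ≤ τ ∧ ∃ y : ℝ → H, IsSolutionOn ι A F 0 τ y ∧ y 0 = x ∧ y τ = z

theorem Steers.trans {x₁ x₂ x₃ : H} (h₁ : Steers ι A F x₁ x₂) (h₂ : Steers ι A F x₂ x₃) :
    Steers ι A F x₁ x₃ := by
  obtain ⟨τ₁, hτ₁, y₁, hy₁, h₁0, h₁τ⟩ := h₁
  obtain ⟨τ₂, hτ₂, y₂, hy₂, h₂0, h₂τ⟩ := h₂
  have e₁ : EqOn (fun t => if t ≤ τ₁ then y₁ t else y₂ (t - τ₁)) y₁ (Icc 0 τ₁) :=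
    fun t ht => if_pos ht.2
  have e₂ : EqOn (fun t => if t ≤ τ₁ then y₁ t else y₂ (t - τ₁)) (fun t => y₂ (t - τ₁))
      (Icc (0 + τ₁) (τ₂ + τ₁)) := by
    intro t ht
    rcases eq_or_lt_of_le ht.1 with h | h
    · obtain rfl : τ₁ = t := by rw [← h, zero_add]
      simp [h₁τ, h₂0]
    · exact if_neg (by linarith)
  have s₂ := (hy₂.comp_sub_right τ₁).congr (by linarith) e₂
  rw [zero_add] at s₂
  refine ⟨τ₂ + τ₁, by linarith, _,
    (hy₁.congr (by linarith) e₁).trans (by linarith) (by linarith) s₂, ?_, ?_⟩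
  · exact (e₁ ⟨le_rfl, by linarith⟩).trans h₁0
  · refine (e₂ ⟨by linarith, le_rfl⟩).trans ?_
    simpa using h₂τ

/-- A trajectory of `F` that ends near `z` is corrected to a trajectory of the enlargement `F'`
that ends at `z`. -/
theorem steers_of_infEDist_lt {F' : H → Set H} {A' : H →L[ℝ] H}
    (hA' : ∀ u : V, A u = toDual ι (A' (ι u))) (hι : Function.Surjective ι) {ε : ℝ}
    (hF' : ∀ x x' : H, ‖x - x'‖ ≤ ε → ∀ f ∈ F x, ∀ g : H, ‖g‖ ≤ (1 + ‖A'‖) * ε → f + g ∈ F' x')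
    {τ : ℝ≥0} (hτ : 1 ≤ τ) {x z : H}
    (h : Metric.infEDist z (flowMap (solutions ι A F) τ x) < ENNReal.ofReal ε) :
    Steers ι A F' x z := by
  obtain ⟨_, ⟨φ, hφ, rfl, rfl⟩, hz⟩ := Metric.infEDist_lt_iff.1 h
  have hτ' : (1 : ℝ) ≤ τ := hτ
  have hτ0 : (0 : ℝ) < τ := by linarith
  obtain ⟨e, he⟩ := hι (z - φ τ)
  have hd : ‖ι e‖ < ε := by
    rw [edist_dist, dist_eq_norm] at hz
    rw [he]
    exact (ENNReal.ofReal_lt_ofReal_iff_of_nonneg (norm_nonneg _)).1 hz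
  have hscale : ∀ r : ℝ, 0 ≤ r → r ≤ 1 → ∀ k : H, ‖r • k‖ ≤ ‖k‖ := fun r h0 h1 k => by
    rw [norm_smul, Real.norm_of_nonneg h0]
    exact mul_le_of_le_one_left (norm_nonneg _) h1
  refine ⟨τ, hτ', _, (IsSolution.isSolutionOn hφ hτ0).add_linear hA' e fun t ht f hf =>
    hF' _ _ ?_ f hf _ ?_, by simp, by simp [hτ0.ne', he]⟩
  · rw [sub_add_cancel_left, norm_neg]
    exact (hscale _ (div_nonneg ht.1.le hτ0.le) ((div_le_one hτ0).2 ht.2) _).trans hd.le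
  · calc ‖(τ : ℝ)⁻¹ • ι e + (t / τ) • A' (ι e)‖ ≤ ‖ι e‖ + ‖A' (ι e)‖ :=
          norm_add_le_of_le (hscale _ (by positivity) (inv_le_one_of_one_le₀ hτ') _)
            (hscale _ (div_nonneg ht.1.le hτ0.le) ((div_le_one hτ0).2 ht.2) _)
      _ ≤ ‖ι e‖ + ‖A'‖ * ‖ι e‖ := by gcongr; exact A'.le_opNorm _
      _ = (1 + ‖A'‖) * ‖ι e‖ := by ring
      _ ≤ (1 + ‖A'‖) * ε := by gcongr

/-- If the links of chains in `B` can be steered, then any two points of a connected chain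
recurrent set can be steered to each other. -/
theorem steers_of_isChainRecurrent {F' : H → Set H} {G : ℝ≥0 → H → Set H} {B : Set H}
    (hB : IsPreconnected B) (hchain : IsChainRecurrent G B) {ε : ℝ} (hε : 0 < ε)
    (hlink : ∀ τ : ℝ≥0, 1 ≤ τ → ∀ x z : H,
      Metric.infEDist z (G τ x) < ENNReal.ofReal ε → Steers ι A F' x z)
    {x z : H} (hx : x ∈ B) (hz : z ∈ B) : Steers ι A F' x z := by
  have hnear : ∀ x ∈ B, ∀ z, dist z x < ε / 2 → Steers ι A F' x z := by
    intro x hx z hxz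
    obtain ⟨n, p, τ, hn, h0, hlast, -, hτ, hp⟩ := hchain x hx (ε / 2) (half_pos hε) 1 one_pos
    have hle : ENNReal.ofReal (ε / 2) ≤ ENNReal.ofReal ε :=
      ENNReal.ofReal_le_ofReal (by linarith)
    -- The target of the last link is kept free, so that the loop at `x` can be diverted to the
    -- nearby point `z`; halving `ε` leaves room for this.
    have hreach : ∀ (k : ℕ) (hk : k < n) (z' : H),
        Metric.infEDist z' (G (τ ⟨k, hk⟩) (p (Fin.castSucc ⟨k, hk⟩))) < ENNReal.ofReal ε →
        Steers ι A F' x z' := by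
      intro k
      induction k with
      | zero =>
        intro hk z' hz'
        have := hlink _ (hτ ⟨0, hk⟩) _ _ hz'
        rwa [show Fin.castSucc ⟨0, hk⟩ = (0 : Fin (n + 1)) from rfl, h0] at this
      | succ k ih =>
        intro hk z' hz'
        exact (ih (k.lt_succ_self.trans hk) _ ((hp ⟨k, k.lt_succ_self.trans hk⟩).trans_le hle)).trans
          (hlink _ (hτ ⟨k + 1, hk⟩) _ _ hz')
    obtain ⟨m, rfl⟩ : ∃ m, n = m + 1 := ⟨n - 1, by omega⟩
    refine hreach m m.lt_succ_self z ?_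
    have hm := hp ⟨m, m.lt_succ_self⟩
    rw [show Fin.succ (⟨m, m.lt_succ_self⟩ : Fin (m + 1)) = Fin.last (m + 1) from rfl, hlast] at hm
    calc _ ≤ _ + edist z x := Metric.infEDist_le_infEDist_add_edist
      _ < ENNReal.ofReal (ε / 2) + ENNReal.ofReal (ε / 2) := by
          refine ENNReal.add_lt_add hm ?_
          rw [edist_dist]
          exact (ENNReal.ofReal_lt_ofReal_iff (half_pos hε)).2 hxz
      _ = ENNReal.ofReal ε := by
          rw [← ENNReal.ofReal_add (half_pos hε).le (half_pos hε).le, add_halves]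
  -- A transitive relation holding both ways between nearby points of a preconnected set holds
  -- throughout it.
  refine hB.induction₂' _ (fun x hx => ?_) (fun _ _ _ _ _ _ h₁ h₂ => h₁.trans h₂) hx hz
  filter_upwards [self_mem_nhdsWithin,
    mem_nhdsWithin_of_mem_nhds (Metric.ball_mem_nhds x (half_pos hε))] with z hz hzx
  exact ⟨hnear x hx z hzx, hnear z hz x (by rwa [dist_comm])⟩

/-- Infinitely many consecutive segments are joined to a solution on `[0, ∞)`. -/
theorem exists_solution_through {p : ℕ → H} (hp : ∀ n, Steers ι A F (p n) (p (n + 1))) :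
    ∃ φ ∈ solutions ι A F, φ 0 = p 0 ∧ ∀ n : ℕ, ∃ t : ℝ≥0, n ≤ t ∧ φ t = p n := by
  choose τ hτ c hc hc0 hcτ using hp
  set T : ℕ → ℝ := fun n => ∑ i ∈ Finset.range n, τ i with hTdef
  have hT0 : T 0 = 0 := Finset.sum_range_zero _
  have hTs : ∀ n, T (n + 1) = T n + τ n := fun n => Finset.sum_range_succ _ _
  have hTmono : Monotone T := monotone_nat_of_le_succ fun n => by linarith [hTs n, hτ n]
  -- Segments of length at least one exhaust `[0, ∞)`.
  have hTn : ∀ n : ℕ, (n : ℝ) ≤ T n := by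
    intro n
    induction n with
    | zero => simp [hT0]
    | succ n ih => push_cast; linarith [hTs n, hτ n]
  have hTnn : ∀ n, 0 ≤ T n := fun n => n.cast_nonneg.trans (hTn n)
  have hex : ∀ t : ℝ, ∃ n, t < T (n + 1) := fun t => by
    obtain ⟨n, hn⟩ := exists_nat_gt t
    exact ⟨n, hn.trans_le ((hTn n).trans (hTmono n.le_succ))⟩
  classical
  -- At a junction `T n` this selects the later segment; the earlier one has the same value there.
  set y : ℝ → H := fun t => c (Nat.find (hex t)) (t - T (Nat.find (hex t))) with hydef
  have hfind : ∀ n t, T n ≤ t → t < T (n + 1) → Nat.find (hex t) = n := fun n t h1 h2 =>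
    (Nat.find_eq_iff _).2 ⟨h2, fun m hm => not_lt.2 ((hTmono hm).trans h1)⟩
  have hyT : ∀ n, y (T n) = p n := fun n => by
    have := hfind n (T n) le_rfl (by linarith [hTs n, hτ n])
    simp only [hydef, this, sub_self, hc0]
  have hyc : ∀ n, EqOn y (fun t => c n (t - T n)) (Icc (0 + T n) (τ n + T n)) := by
    intro n t ht
    rcases lt_or_eq_of_le ht.2 with h | h
    · simp only [hydef, hfind n t (by linarith [ht.1]) (by linarith [hTs n])]
    · have htT : t = T (n + 1) := by linarith [hTs n]
      rw [htT, hyT, hTs]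
      simp [hcτ]
  have hyT' : ∀ n, IsSolutionOn ι A F 0 (T (n + 1)) y := by
    have hseg : ∀ n, IsSolutionOn ι A F (T n) (T (n + 1)) y := fun n => by
      have := ((hc n).comp_sub_right (T n)).congr (by linarith [hτ n]) (hyc n)
      rwa [zero_add, add_comm, ← hTs] at this
    intro n
    induction n with
    | zero => simpa only [hT0] using hseg 0
    | succ n ih => exact ih.trans (hTnn _) (hTmono (Nat.le_succ _)) (hseg (n + 1))
  have hyS : ∀ S : ℝ, IsSolutionOn ι A F 0 S y := fun S => by
    obtain ⟨n, hn⟩ := hex S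
    exact (hyT' n).mono_right hn.le
  have hcont : Continuous fun t : ℝ≥0 => y t := by
    refine continuous_iff_continuousAt.2 fun t => ?_
    have h1 : ContinuousWithinAt y (Icc 0 (t + 1 : ℝ)) t :=
      (hyS (t + 1)).1 t ⟨t.2, by linarith⟩
    refine Tendsto.comp h1 (tendsto_nhdsWithin_iff.2 ⟨NNReal.continuous_coe.continuousAt, ?_⟩)
    filter_upwards [Iio_mem_nhds (lt_add_one t)] with u hu
    exact ⟨u.2, by exact_mod_cast (mem_Iio.1 hu).le⟩
  refine ⟨⟨fun t => y t, hcont⟩, isSolution_of_isSolutionOn (fun _ => rfl) fun S _ => hyS S,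
    ?_, fun n => ⟨⟨T n, hTnn n⟩, hTn n, hyT n⟩⟩
  have := hyT 0
  rwa [hT0] at this

end Segments

/-! ### Surjectivity of the embedding -/

/-- A coercive operator that is bounded on the larger space makes a dense embedding onto. -/
theorem surjective_of_coercive_of_bounded {V H : Type*}
    [NormedAddCommGroup V] [NormedSpace ℝ V] [CompleteSpace V]
    [NormedAddCommGroup H] [InnerProductSpace ℝ H]
    {ι : V →L[ℝ] H} (hι : DenseRange ι) {A : V →L[ℝ] (V →L[ℝ] ℝ)} {l : ℝ} (hl : 0 < l)
    (hA : ∀ u : V, l * ‖u‖ ^ 2 ≤ A u u) {A' : H →L[ℝ] H}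
    (hA' : ∀ u : V, A u = toDual ι (A' (ι u))) : Function.Surjective ι := by
  have hanti : AntilipschitzWith (Real.toNNReal (√(‖A'‖ / l))) ι := by
    refine ι.antilipschitz_of_bound fun u => ?_
    rw [Real.coe_toNNReal _ (Real.sqrt_nonneg _)]
    -- This bounds the norm of `V` by that of `H`; as `V` is complete, the dense range is closed.
    have h1 : l * ‖u‖ ^ 2 ≤ ‖A'‖ * ‖ι u‖ ^ 2 := by
      calc l * ‖u‖ ^ 2 ≤ A u u := hA u
        _ = ⟪A' (ι u), ι u⟫_ℝ := by rw [hA' u]; rfl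
        _ ≤ ‖A' (ι u)‖ * ‖ι u‖ := real_inner_le_norm _ _
        _ ≤ ‖A'‖ * ‖ι u‖ * ‖ι u‖ := by gcongr; exact A'.le_opNorm _
        _ = ‖A'‖ * ‖ι u‖ ^ 2 := by ring
    refine le_of_sq_le_sq ?_ (by positivity)
    rw [mul_pow, Real.sq_sqrt (by positivity), div_mul_eq_mul_div, le_div_iff₀ hl]
    linarith
  have hclosed : IsClosed (range ι) := hanti.isClosed_range ι.uniformContinuous
  rw [← range_eq_univ, ← hclosed.closure_eq, hι.closure_range]

end EvolInclusion

/-! ### The main theorem -/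

open EvolInclusion
theorem mainTheorem6
    {V H : Type*}
    [NormedAddCommGroup V] [NormedSpace ℝ V] [CompleteSpace V]
    [NormedAddCommGroup H] [InnerProductSpace ℝ H] [CompleteSpace H]
    (ι : V →L[ℝ] H) (hι_inj : Function.Injective ι) (hι_dense : DenseRange ι)
    (hι_compact : IsCompactOperator ι)
    (A : V →L[ℝ] (V →L[ℝ] ℝ)) (hA_symm : ∀ u v : V, A u v = A v u)
    (l₁ l₂ : ℝ) (hl₁ : 0 < l₁) (hl₁₂ : l₁ < l₂)
    (hA_lower : ∀ u : V, l₁ * ‖u‖ ^ 2 ≤ A u u)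
    (hA_upper : ∀ u : V, A u u ≤ l₂ * ‖u‖ ^ 2)
    (hA_bdd : ∃ A' : H →L[ℝ] H, ∀ u : V, A u = toDual ι (A' (ι u)))
    (F : H → Set H) (hF : IsAdmissible F)
    (hF_approx : ∃ F' : ℕ → H → Set H, IsLipschitzApproximation F F')
    (B : Set H) (hB_compact : IsCompact B) (hB_conn : IsConnected B)
    (hB_inv : IsQuasiInvariant (solutions ι A F) B)
    (hB_chain : IsChainRecurrent (flowMap (solutions ι A F)) B) :
    ∃ FN : ℕ → H → Set H,
      (∀ N, 1 ≤ N → IsAdmissible (FN N)) ∧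
      (∀ y : H, Tendsto (fun N => Metric.hausdorffEDist (FN N y) (F y)) atTop (𝓝 0)) ∧
      ∀ y₀ ∈ B, ∀ N, 1 ≤ N → ∃ y ∈ solutions ι A (FN N),
        y 0 = y₀ ∧ B ⊆ omegaLimitSet y := by
  obtain ⟨A', hA'⟩ := hA_bdd
  obtain ⟨F', hF'⟩ := hF_approx
  have hι := surjective_of_coercive_of_bounded hι_dense hl₁ hA_lower hA'
  refine ⟨fun N y => Metric.cthickening (1 / ((N : ℝ) + 1)) (F' N y), fun N hN => ?_,
    tendsto_hausdorffEDist_cthickening hF' tendsto_one_div_add_atTop_nhds_zero_nat,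
    fun y₀ hy₀ N hN => ?_⟩
  · obtain ⟨c, hc, hlip⟩ := hF'.lipschitz N hN
    exact (hF'.values N hN).isAdmissible_cthickening hc (by positivity) hlip
  obtain ⟨c, hc, hlip⟩ := hF'.lipschitz N hN
  set δ : ℝ := 1 / ((N : ℝ) + 1)
  have hδ : 0 < δ := by positivity
  -- The margin `δ` is split between the displaced state (`c * ε`) and the extra forcing.
  obtain ⟨ε, hε, hεδ⟩ : ∃ ε : ℝ, 0 < ε ∧ c * ε + (1 + ‖A'‖) * ε = δ :=
    ⟨δ / (c + (1 + ‖A'‖)), by positivity, by field_simp⟩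
  have henl : ∀ x x' : H, ‖x - x'‖ ≤ ε → ∀ f ∈ F x, ∀ g : H, ‖g‖ ≤ (1 + ‖A'‖) * ε →
      f + g ∈ Metric.cthickening δ (F' N x') := by
    intro x x' hx f hf g hg
    rw [Metric.mem_cthickening_iff, ← hεδ, ENNReal.ofReal_add (by positivity) (by positivity)]
    refine (Metric.infEDist_le_infEDist_add_edist (y := f)).trans (add_le_add ?_ ?_)
    · refine (Metric.infEDist_le_hausdorffEDist_of_mem (hF'.subset N hN x hf)).trans
        ((hlip x x').trans (ENNReal.ofReal_le_ofReal ?_))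
      gcongr
    · rw [edist_dist, dist_eq_norm, add_sub_cancel_left]
      exact ENNReal.ofReal_le_ofReal hg
  have hsteer : ∀ x ∈ B, ∀ z ∈ B,
      Steers ι A (fun y => Metric.cthickening δ (F' N y)) x z := fun x hx z hz =>
    steers_of_isChainRecurrent hB_conn.isPreconnected hB_chain hε
      (fun _ hτ _ _ h => steers_of_infEDist_lt hA' hι henl hτ h) hx hz
  have : CompactSpace B := isCompact_iff_compactSpace.1 hB_compact
  have : Nonempty B := ⟨⟨y₀, hy₀⟩⟩
  set d : ℕ → B := TopologicalSpace.denseSeq B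
  -- After `y₀`, unpairing lists each `d k` infinitely often; `Nat.pair k m ≥ m` makes the visits
  -- late.
  set p : ℕ → B := fun n => Nat.casesOn n ⟨y₀, hy₀⟩ fun m => d m.unpair.1
  obtain ⟨φ, hφ, hφ0, hφp⟩ := exists_solution_through (p := fun n => (p n : H))
    fun n => hsteer _ (p n).2 _ (p (n + 1)).2
  refine ⟨φ, hφ, hφ0, subset_iInter fun s => ?_⟩
  have hd : ∀ k, (d k : H) ∈ φ '' Ici s := by
    intro k
    obtain ⟨m, hm⟩ := exists_nat_ge s
    obtain ⟨t, ht, htp⟩ := hφp (Nat.pair k m + 1)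
    refine ⟨t, hm.trans (le_trans ?_ ht), by rw [htp]; simp [p]⟩
    exact_mod_cast (Nat.right_le_pair k m).trans (Nat.le_succ _)
  intro x hx
  have hmem : (⟨x, hx⟩ : B) ∈ closure (range d) := TopologicalSpace.denseRange_denseSeq B _
  exact map_mem_closure continuous_subtype_val hmem (forall_mem_range.2 hd)
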